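/- A real number is called an $N$-ary fraction if it can be written as $z/N^t$ with $z\in\mathbb{Z}$ and $t\in\mathbb{Z}_{\ge 0}$. A ReLU network with $k\ge 0$ hidden layers, $n$ inputs and one output consists of $k+1$ affine maps $T^{(i)}\colon\mathbb{R}^{n_{i-1}}\to\mathbb{R}^{n_i}$, $T^{(i)}(x)=A^{(i)}x+b^{(i)}$ ($i=1,\dots,k+1$), with $n_0=n$, $n_{k+1}=1$ and arbitrary widths $n_1,\dots,n_k$; the entries of the real matrices $A^{(i)}$ are its weights and those of the real vectors $b^{(i)}$ are its biases. It exactly represents $f\colon\mathbb{R}^n\to\mathbb{R}$ if $$T^{(k+1)}\circ\sigma\circ T^{(k)}\circ\sigma\circ\cdots\circ T^{(2)}\circ\sigma\circ T^{(1)}=f$$ on all of $\mathbb{R}^n$, where $\sigma$ applies $s\mapsto\max\{0,s\}$ to every component. Theorem. Let $n$ and $N$ be positive integers and let $p$ be a prime number that does not divide $N$. If a ReLU network with $k$ hidden layers, all of whose weights are $N$-ary fractions (the biases may be arbitrary real numbers), exactly represents the function $(x_1,\dots,x_n)\mapsto\max\{0,x_1,\dots,x_n\}$, then $k\ge\lceil\log_p(n+1)\rceil$.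 -/

import Mathlib

open scoped Matrix

noncomputable section

/-- A real number is an `N`-ary fraction if it equals `z / N ^ t` with `z` an integer and `t` a
non-negative integer. -/
def IsNaryFraction (N : ℕ) (r : ℝ) : Prop :=
  ∃ (z : ℤ) (t : ℕ), r = (z : ℝ) / (N : ℝ) ^ t

/-- Component-wise application of the ReLU activation function `s ↦ max {0, s}`. -/
def relu {m : ℕ} (y : Fin m → ℝ) : Fin m → ℝ := fun i => max 0 (y i)

/-- `ReLUNetwork k n m` is the type of feedforward ReLU networks with `k` hidden layers, input
dimension `n` and output dimension `m`, that is, with `k + 1` affine layers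
`x ↦ A x + b`; the widths of the hidden layers are arbitrary. The constructor `hidden A b net`
puts the hidden layer given by `A` and `b` in front of the network `net`. -/
inductive ReLUNetwork : ℕ → ℕ → ℕ → Type
  | output {n m : ℕ} (A : Matrix (Fin m) (Fin n) ℝ) (b : Fin m → ℝ) : ReLUNetwork 0 n m
  | hidden {k n l m : ℕ} (A : Matrix (Fin l) (Fin n) ℝ) (b : Fin l → ℝ)
      (net : ReLUNetwork k l m) : ReLUNetwork (k + 1) n m

namespace ReLUNetwork

/-- The function computed by a network: the alternating composition of its affine maps with the
component-wise ReLU function, with no activation after the last affine map. -/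
def eval : {k n m : ℕ} → ReLUNetwork k n m → (Fin n → ℝ) → (Fin m → ℝ)
  | _, _, _, output A b, x => A *ᵥ x + b
  | _, _, _, hidden A b net, x => net.eval (relu (A *ᵥ x + b))

/-- All weights of the network, i.e. all entries of its matrices, satisfy `P`. The biases are
not constrained. -/
def AllWeights (P : ℝ → Prop) : {k n m : ℕ} → ReLUNetwork k n m → Prop
  | _, _, _, output A _ => ∀ i j, P (A i j)
  | _, _, _, hidden A _ net => (∀ i j, P (A i j)) ∧ net.AllWeights P

/-- A network with one output exactly represents `f`. -/
def Represents {k n : ℕ} (net : ReLUNetwork k n 1) (f : (Fin n → ℝ) → ℝ) : Prop :=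
  ∀ x, net.eval x 0 = f x

end ReLUNetwork

/-- The function `(x₁, …, xₙ) ↦ max {0, x₁, …, xₙ}`. -/
def maxZero (n : ℕ) (x : Fin n → ℝ) : ℝ :=
  Finset.univ.sup' Finset.univ_nonempty (Fin.cons 0 x : Fin (n + 1) → ℝ)

end

/-! The proof is a divisibility argument at `p`. The weights lie in a valuation ring `O` of `ℝ` with
`p⁻¹ ∉ O` (`exists_valuationSubring_nary`). The biases can be dropped, because the maximum is
positively homogeneous and hence equals its recession function, which the network with zero biases
computes. Every neuron is then a piecewise linear function over `O`.

In the ring of continuous piecewise polynomial functions over `O`, let `I` be the ideal generated by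
`p` and the coordinates. If `f ^ p ^ j ∈ I` for all neurons `f` of one layer, the same holds for
their `O`-combinations, since `p ^ j`-th powers are additive modulo `p`. For `r = max 0 f` the
identity `r² = r f` gives `r ^ p ^ (j + 1) ∈ I`. Hence the `p ^ k`-th power of the output lies in
`I`.

On the other hand, the `n`-th power of the maximum is not in `I` (`maxZero_pow_ne`). This uses an
operator that lowers the dimension, the jump sum in the first coordinate `t`: where two adjacent
polynomial pieces differ by `q(t) (t - ℓ)`, add `q(0)`. It is linear over functions of the other
coordinates, kills multiples of `t`, and sends `max(t, m) ^ (n + 1)` to `m ^ n`. It also keeps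
coefficients in `O` (`IsPiecewisePolynomial.exists_jumpSum`). Induction ends in dimension zero with
`1 = p a`, `a ∈ O`, which is impossible. Therefore `n < p ^ k`. -/

open Filter Topology MvPolynomial

/-! ### Integrality at `p`. -/

/-- There is a valuation ring of `ℝ` that contains all `N`-ary fractions and in which the prime
`p ∤ N` is not invertible. -/
theorem exists_valuationSubring_nary {N p : ℕ} (hp : p.Prime) (hpN : ¬ p ∣ N) :
    ∃ O : ValuationSubring ℝ, (p : ℝ)⁻¹ ∉ O ∧ ∀ r, IsNaryFraction N r → r ∈ O := by
  let A : Subring ℝ := (Int.castRingHom ℝ).range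
  have hI : Ideal.span {((p : ℕ) : A)} ≠ ⊤ := by
    rw [Ne, Ideal.span_singleton_eq_top]
    intro hu
    obtain ⟨⟨_, z, rfl⟩, hb⟩ := isUnit_iff_exists_inv.mp hu
    have h1 : ((p : ℤ) * z : ℤ) = 1 := by
      have := congrArg Subtype.val hb
      simp only [Subring.coe_mul, Subring.coe_natCast, Subring.coe_one, eq_intCast] at this
      exact_mod_cast this
    have h2 : (p : ℤ) ∣ 1 := ⟨z, h1.symm⟩
    exact hp.one_lt.ne' (by exact_mod_cast Int.eq_one_of_dvd_one (by positivity) h2)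
  obtain ⟨O, hAO, hO⟩ := Ideal.image_subset_nonunits_valuationSubring _ hI
  have hpn : (p : ℝ) ∈ O.nonunits := hO ⟨_, Ideal.mem_span_singleton_self _, by simp⟩
  have hp0 : (p : ℝ) ≠ 0 := by exact_mod_cast hp.ne_zero
  have hpinv : (p : ℝ)⁻¹ ∉ O := by
    have := (O.inv_mem_nonunits_iff (x := (p : ℝ)⁻¹)).mp (by simpa using hpn)
    exact this.resolve_left (inv_ne_zero hp0)
  refine ⟨O, hpinv, ?_⟩
  have hNinv : (N : ℝ)⁻¹ ∈ O := by
    have hN0 : (N : ℝ) ≠ 0 := by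
      rintro h
      exact hpN (by simp [Nat.cast_eq_zero.mp h])
    -- With `u p + v N = 1`, either `p / N ∈ O` and `1 / N = u (p / N) + v`, or `N / p ∈ O` and `1 /
    -- p = v (N / p) + u`, which is excluded.
    rcases O.mem_or_inv_mem ((N : ℝ)⁻¹ * p) with h | h
    · have hc : IsCoprime (p : ℤ) (N : ℤ) :=
        Nat.isCoprime_iff_coprime.mpr ((Nat.Prime.coprime_iff_not_dvd hp).mpr hpN)
      obtain ⟨u, v, huv⟩ := hc
      have huv' : (u : ℝ) * p + v * N = 1 := by exact_mod_cast huv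
      have : (N : ℝ)⁻¹ = u * ((N : ℝ)⁻¹ * p) + v := by
        field_simp
        linarith
      rw [this]
      exact add_mem (mul_mem (intCast_mem O u) h) (intCast_mem O v)
    · exfalso
      apply hpinv
      have hc : IsCoprime (p : ℤ) (N : ℤ) :=
        Nat.isCoprime_iff_coprime.mpr ((Nat.Prime.coprime_iff_not_dvd hp).mpr hpN)
      obtain ⟨u, v, huv⟩ := hc
      have huv' : (u : ℝ) * p + v * N = 1 := by exact_mod_cast huv
      have : (p : ℝ)⁻¹ = v * ((N : ℝ)⁻¹ * p)⁻¹ + u := by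
        field_simp
        linarith
      rw [this]
      exact add_mem (mul_mem (intCast_mem O v) h) (intCast_mem O u)
  rintro r ⟨z, t, rfl⟩
  rw [div_eq_mul_inv, ← inv_pow]
  exact mul_mem (intCast_mem O z) (pow_mem hNinv t)

/-! ### Divisibility by linear forms over a valuation ring. -/

/-- Over a valuation ring, a nonzero vector is a multiple of an integral vector one of whose
entries is `1`. -/
theorem exists_normalized_vector {n : ℕ} (O : ValuationSubring ℝ) (v : Fin n → ℝ) (hv : v ≠ 0) :
    ∃ (c : ℝ) (w : Fin n → O) (i : Fin n), c ≠ 0 ∧ w i = 1 ∧ ∀ j, v j = c * w j := by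
  obtain ⟨j₀, hj₀⟩ := Function.ne_iff.mp hv
  -- Dividing by an entry of maximal valuation makes all entries integral.
  obtain ⟨i, -, hi⟩ := Finset.exists_max_image Finset.univ (fun j => O.valuation (v j))
    ⟨j₀, Finset.mem_univ _⟩
  have hvi : v i ≠ 0 := by
    intro h
    have := hi j₀ (Finset.mem_univ _)
    rw [h, map_zero, le_zero_iff, map_eq_zero] at this
    exact hj₀ this
  have hmem : ∀ j, v j / v i ∈ O := by
    intro j
    rw [← O.valuation_le_one_iff, map_div₀]
    exact div_le_one_of_le₀ (hi j (Finset.mem_univ _)) zero_le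
  refine ⟨v i, fun j => ⟨v j / v i, hmem j⟩, i, hvi, ?_, fun j => ?_⟩
  · ext
    simp [hvi]
  · simp only
    field_simp

/-- A ball for the sup norm is a product of infinite sets, and on such a product only the zero
polynomial vanishes. -/
theorem MvPolynomial.eq_zero_of_eventually_aeval_eq_zero {n : ℕ} {O : ValuationSubring ℝ}
    (g : MvPolynomial (Fin n) O) (x₀ : Fin n → ℝ) (h : ∀ᶠ x in 𝓝 x₀, aeval x g = 0) : g = 0 := by
  obtain ⟨ε, hε, hball⟩ := Metric.eventually_nhds_iff_ball.mp h
  have hinj : Function.Injective (algebraMap O ℝ) := Subtype.val_injective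
  apply MvPolynomial.map_injective _ hinj
  rw [map_zero]
  refine MvPolynomial.funext_set (fun i => Metric.ball (x₀ i) ε) (fun i => ?_) fun x hx => ?_
  · rw [Real.ball_eq_Ioo]
    exact Set.Ioo_infinite (by linarith)
  · rw [map_zero, eval_map, ← aeval_def]
    apply hball
    rw [ball_pi _ hε]
    exact hx

/-- A polynomial vanishing on a relatively open part of the hyperplane of a linear form with a
coefficient `1` is divisible by that form, with integral quotient. -/
theorem MvPolynomial.exists_eq_linear_mul {n : ℕ} {O : ValuationSubring ℝ} (w : Fin n → O)
    {i : Fin n} (hi : w i = 1) (g : MvPolynomial (Fin n) O) (x₀ : Fin n → ℝ)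
    (hx₀ : ∑ j, (w j : ℝ) * x₀ j = 0)
    (hg : ∀ᶠ x in 𝓝 x₀, ∑ j, (w j : ℝ) * x j = 0 → aeval x g = 0) :
    ∃ q, g = (∑ j, C (w j) * X j) * q := by
  set W : MvPolynomial (Fin n) O := ∑ j, C (w j) * X j with hW
  -- The substitution `x ↦ x - W(x) eᵢ` projects onto the hyperplane `W = 0` because `w i = 1`. It
  -- is the identity modulo `W`, and it turns `g` into a polynomial vanishing near `x₀`.
  let τ : Fin n → MvPolynomial (Fin n) O := fun j => X j - if j = i then W else 0
  have hWx : ∀ x : Fin n → ℝ, aeval x W = ∑ j, (w j : ℝ) * x j := by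
    intro x
    simp only [hW, map_sum, map_mul, aeval_X, aeval_C]
    rfl
  have hdvd : W ∣ g - bind₁ τ g := by
    rw [← Ideal.mem_span_singleton, ← Ideal.Quotient.eq]
    have : (Ideal.Quotient.mk (Ideal.span {W})) =
        (Ideal.Quotient.mk (Ideal.span {W})).comp (bind₁ τ).toRingHom := by
      apply MvPolynomial.ringHom_ext
      · intro r
        simp
      · intro j
        simp only [AlgHom.toRingHom_eq_coe, RingHom.coe_comp, RingHom.coe_coe, Function.comp_apply,
          bind₁_X_right, τ]
        rw [Ideal.Quotient.eq, Ideal.mem_span_singleton]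
        split_ifs <;> simp
    exact congrArg (fun f => f g) this
  have hproj : ∀ x : Fin n → ℝ, ∑ j, (w j : ℝ) * aeval x (τ j) = 0 := by
    intro x
    have : ∀ j, (w j : ℝ) * aeval x (τ j) =
        (w j : ℝ) * x j - if j = i then (w j : ℝ) * aeval x W else 0 := by
      intro j
      simp only [τ, map_sub, aeval_X]
      split_ifs <;> simp [mul_sub]
    simp only [this, Finset.sum_sub_distrib, Finset.sum_ite_eq', Finset.mem_univ, if_true, hi, hWx]
    simp
  have hzero : bind₁ τ g = 0 := by
    apply MvPolynomial.eq_zero_of_eventually_aeval_eq_zero _ x₀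
    have hcont : Continuous fun (x : Fin n → ℝ) j => aeval x (τ j) := by
      refine continuous_pi fun j => ?_
      simp only [τ, map_sub, aeval_X]
      split_ifs
      · simp only [hWx]
        fun_prop
      · simp only [map_zero]
        fun_prop
    have hfix : (fun j => aeval x₀ (τ j)) = x₀ := by
      funext j
      simp only [τ, map_sub, aeval_X]
      split_ifs <;> simp [hWx, hx₀]
    have ht : Tendsto (fun (x : Fin n → ℝ) j => aeval x (τ j)) (𝓝 x₀) (𝓝 x₀) := by
      simpa only [hfix] using hcont.tendsto x₀
    filter_upwards [ht.eventually hg] with x hx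
    rw [aeval_bind₁]
    exact hx (hproj x)
  rw [hzero, sub_zero] at hdvd
  exact hdvd

/-! ### Hyperplane arrangements and piecewise functions. -/

/-- The point `x₀` lies on none of the hyperplanes of the nonzero forms in `H`. -/
def AvoidsWalls {n : ℕ} (H : Finset (Fin n → ℝ)) (x₀ : Fin n → ℝ) : Prop :=
  ∀ h ∈ H, h ≠ 0 → h ⬝ᵥ x₀ ≠ 0

/-- The closed cell around `x₀` of the hyperplane arrangement given by `H`. -/
def closedCell {n : ℕ} (H : Finset (Fin n → ℝ)) (x₀ : Fin n → ℝ) : Set (Fin n → ℝ) :=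
  {x | ∀ h ∈ H, 0 ≤ (h ⬝ᵥ x₀) * (h ⬝ᵥ x)}

/-- `f` is piecewise linear, and its finitely many linear pieces have coefficients in `O`. -/
def IsPiecewiseLinear (O : ValuationSubring ℝ) {n : ℕ} (f : (Fin n → ℝ) → ℝ) : Prop :=
  ∃ (H : Finset (Fin n → ℝ)) (Λ : Finset (Fin n → O)), ∀ x₀, AvoidsWalls H x₀ →
    ∃ l ∈ Λ, ∀ x ∈ closedCell H x₀, f x = ∑ i, (l i : ℝ) * x i

/-- On each full-dimensional closed cell of some hyperplane arrangement, `f` is given by a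
polynomial with coefficients in `O`. Such a function is continuous. -/
def IsPiecewisePolynomial (O : ValuationSubring ℝ) {n : ℕ} (f : (Fin n → ℝ) → ℝ) : Prop :=
  ∃ H : Finset (Fin n → ℝ), ∀ x₀, AvoidsWalls H x₀ →
    ∃ g : MvPolynomial (Fin n) O, ∀ x ∈ closedCell H x₀, f x = aeval x g

theorem AvoidsWalls.mono {n : ℕ} {H H' : Finset (Fin n → ℝ)} {x₀ : Fin n → ℝ} (h : H ⊆ H')
    (hx : AvoidsWalls H' x₀) : AvoidsWalls H x₀ := fun l hl => hx l (h hl)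

theorem closedCell_anti {n : ℕ} {H H' : Finset (Fin n → ℝ)} {x₀ : Fin n → ℝ} (h : H ⊆ H') :
    closedCell H' x₀ ⊆ closedCell H x₀ := fun _ hx l hl => hx l (h hl)

/-- The product of the nonzero forms is a nonzero polynomial, so it is nonzero at some point. -/
theorem exists_avoidsWalls {n : ℕ} (H : Finset (Fin n → ℝ)) : ∃ v, AvoidsWalls H v := by
  classical
  let L : (Fin n → ℝ) → MvPolynomial (Fin n) ℝ := fun h => ∑ j, C (h j) * X j
  have hL : ∀ h x, eval x (L h) = h ⬝ᵥ x := by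
    intro h x
    simp [L, dotProduct]
  have hne : ∏ h ∈ H.filter (· ≠ 0), L h ≠ 0 := by
    rw [Finset.prod_ne_zero_iff]
    intro h hh h0
    apply (Finset.mem_filter.mp hh).2
    rw [← dotProduct_self_eq_zero, ← hL, h0, map_zero]
  by_contra hcon
  apply hne
  apply MvPolynomial.funext
  intro x
  rw [map_prod, map_zero, Finset.prod_eq_zero_iff]
  simp only [AvoidsWalls, not_exists, not_forall, not_not] at hcon
  obtain ⟨h, hh, h0, hx⟩ := hcon x
  exact ⟨h, by simp [hh, h0], by rw [hL, hx]⟩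

/-- The full-dimensional closed cells cover the space. -/
theorem exists_mem_closedCell {n : ℕ} (H : Finset (Fin n → ℝ)) (x : Fin n → ℝ) :
    ∃ x₀, AvoidsWalls H x₀ ∧ x ∈ closedCell H x₀ := by
  obtain ⟨v, hv⟩ := exists_avoidsWalls H
  -- A small shift in a generic direction leaves the walls through `x` and does not cross the
  -- others.
  have key : ∀ᶠ ε : ℝ in 𝓝[>] 0, ∀ h ∈ H,
      (h ≠ 0 → h ⬝ᵥ (x + ε • v) ≠ 0) ∧ 0 ≤ (h ⬝ᵥ (x + ε • v)) * (h ⬝ᵥ x) := by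
    rw [Filter.eventually_all_finset]
    intro h hh
    simp only [dotProduct_add, dotProduct_smul, smul_eq_mul]
    by_cases hx : h ⬝ᵥ x = 0
    · filter_upwards [self_mem_nhdsWithin] with ε hε
      rw [hx]
      refine ⟨fun h0 => ?_, by simp⟩
      rw [zero_add]
      exact mul_ne_zero (ne_of_gt hε) (hv h hh h0)
    · have hc : Tendsto (fun ε : ℝ => (h ⬝ᵥ x + ε * (h ⬝ᵥ v)) * (h ⬝ᵥ x)) (𝓝[>] 0)
          (𝓝 ((h ⬝ᵥ x + 0 * (h ⬝ᵥ v)) * (h ⬝ᵥ x))) := by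
        apply Tendsto.mono_left _ nhdsWithin_le_nhds
        exact Continuous.tendsto (by fun_prop) 0
      rw [zero_mul, add_zero] at hc
      filter_upwards [hc.eventually (lt_mem_nhds (mul_self_pos.mpr hx))] with ε hε
      exact ⟨fun _ h0 => by simp [h0] at hε, hε.le⟩
  obtain ⟨ε, hε⟩ := key.exists
  exact ⟨x + ε • v, fun h hh => (hε h hh).1, fun h hh => (hε h hh).2⟩

section PiecewisePolynomial

variable {O : ValuationSubring ℝ} {n : ℕ} {f g : (Fin n → ℝ) → ℝ}

theorem isPiecewisePolynomial_const {c : ℝ} (hc : c ∈ O) :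
    IsPiecewisePolynomial O fun _ : Fin n → ℝ => c :=
  ⟨∅, fun _ _ => ⟨C ⟨c, hc⟩, fun x _ => (aeval_C x (⟨c, hc⟩ : O)).symm⟩⟩

theorem IsPiecewisePolynomial.add (hf : IsPiecewisePolynomial O f)
    (hg : IsPiecewisePolynomial O g) : IsPiecewisePolynomial O (f + g) := by
  classical
  obtain ⟨H, hH⟩ := hf
  obtain ⟨H', hH'⟩ := hg
  refine ⟨H ∪ H', fun x₀ hx₀ => ?_⟩
  obtain ⟨a, ha⟩ := hH x₀ (hx₀.mono Finset.subset_union_left)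
  obtain ⟨b, hb⟩ := hH' x₀ (hx₀.mono Finset.subset_union_right)
  refine ⟨a + b, fun x hx => ?_⟩
  rw [Pi.add_apply, ha x (closedCell_anti Finset.subset_union_left hx),
    hb x (closedCell_anti Finset.subset_union_right hx), map_add]

theorem IsPiecewisePolynomial.mul (hf : IsPiecewisePolynomial O f)
    (hg : IsPiecewisePolynomial O g) : IsPiecewisePolynomial O (f * g) := by
  classical
  obtain ⟨H, hH⟩ := hf
  obtain ⟨H', hH'⟩ := hg
  refine ⟨H ∪ H', fun x₀ hx₀ => ?_⟩
  obtain ⟨a, ha⟩ := hH x₀ (hx₀.mono Finset.subset_union_left)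
  obtain ⟨b, hb⟩ := hH' x₀ (hx₀.mono Finset.subset_union_right)
  refine ⟨a * b, fun x hx => ?_⟩
  rw [Pi.mul_apply, ha x (closedCell_anti Finset.subset_union_left hx),
    hb x (closedCell_anti Finset.subset_union_right hx), map_mul]

variable (O n) in
/-- The ring of continuous piecewise polynomial functions on `ℝⁿ` with coefficients in `O`. -/
def piecewisePolynomialRing : Subring ((Fin n → ℝ) → ℝ) where
  carrier := {f | IsPiecewisePolynomial O f}
  mul_mem' := IsPiecewisePolynomial.mul
  add_mem' := IsPiecewisePolynomial.add
  one_mem' := ⟨∅, fun _ _ => ⟨1, fun _ _ => by simp⟩⟩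
  zero_mem' := ⟨∅, fun _ _ => ⟨0, fun _ _ => by simp⟩⟩
  neg_mem' := by
    rintro f ⟨H, hH⟩
    refine ⟨H, fun x₀ hx₀ => ?_⟩
    obtain ⟨a, ha⟩ := hH x₀ hx₀
    exact ⟨-a, fun x hx => by rw [Pi.neg_apply, ha x hx, map_neg]⟩

theorem IsPiecewiseLinear.isPiecewisePolynomial (hf : IsPiecewiseLinear O f) :
    IsPiecewisePolynomial O f := by
  obtain ⟨H, Λ, hH⟩ := hf
  refine ⟨H, fun x₀ hx₀ => ?_⟩
  obtain ⟨l, -, hl⟩ := hH x₀ hx₀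
  refine ⟨∑ i, C (l i) * X i, fun x hx => ?_⟩
  rw [hl x hx]
  simp only [map_sum, map_mul, aeval_X, aeval_C]
  rfl

theorem isPiecewiseLinear_coord (i : Fin n) : IsPiecewiseLinear O fun x => x i := by
  classical
  refine ⟨∅, {Pi.single i 1}, fun x₀ _ => ⟨_, Finset.mem_singleton_self _, fun x _ => ?_⟩⟩
  simp [Pi.single_apply, apply_ite]

theorem isPiecewiseLinear_zero : IsPiecewiseLinear O (0 : (Fin n → ℝ) → ℝ) :=
  ⟨∅, {0}, fun _ _ => ⟨0, Finset.mem_singleton_self _, fun _ _ => by simp⟩⟩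

theorem IsPiecewiseLinear.add (hf : IsPiecewiseLinear O f) (hg : IsPiecewiseLinear O g) :
    IsPiecewiseLinear O (f + g) := by
  classical
  obtain ⟨H, Λ, hH⟩ := hf
  obtain ⟨H', Λ', hH'⟩ := hg
  refine ⟨H ∪ H', Finset.image₂ (· + ·) Λ Λ', fun x₀ hx₀ => ?_⟩
  obtain ⟨a, haΛ, ha⟩ := hH x₀ (hx₀.mono Finset.subset_union_left)
  obtain ⟨b, hbΛ, hb⟩ := hH' x₀ (hx₀.mono Finset.subset_union_right)
  refine ⟨a + b, Finset.mem_image₂_of_mem haΛ hbΛ, fun x hx => ?_⟩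
  rw [Pi.add_apply, ha x (closedCell_anti Finset.subset_union_left hx),
    hb x (closedCell_anti Finset.subset_union_right hx), ← Finset.sum_add_distrib]
  simp [add_mul]

theorem IsPiecewiseLinear.smul (hf : IsPiecewiseLinear O f) {c : ℝ} (hc : c ∈ O) :
    IsPiecewiseLinear O (c • f) := by
  classical
  obtain ⟨H, Λ, hH⟩ := hf
  refine ⟨H, Λ.image fun l => (⟨c, hc⟩ : O) • l, fun x₀ hx₀ => ?_⟩
  obtain ⟨a, haΛ, ha⟩ := hH x₀ hx₀
  refine ⟨_, Finset.mem_image_of_mem _ haΛ, fun x hx => ?_⟩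
  rw [Pi.smul_apply, ha x hx, smul_eq_mul, Finset.mul_sum]
  simp [mul_assoc]

theorem IsPiecewiseLinear.sum {ι : Type*} (s : Finset ι) {F : ι → (Fin n → ℝ) → ℝ}
    (hF : ∀ i ∈ s, IsPiecewiseLinear O (F i)) : IsPiecewiseLinear O (∑ i ∈ s, F i) :=
  Finset.sum_induction F _ (fun _ _ => IsPiecewiseLinear.add) isPiecewiseLinear_zero hF

/-- Taking the kernels of the linear pieces as additional walls fixes the sign of `f` on each cell.
Only finitely many walls are added because `Λ` is finite. -/
theorem IsPiecewiseLinear.max_zero (hf : IsPiecewiseLinear O f) :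
    IsPiecewiseLinear O fun x => max 0 (f x) := by
  classical
  obtain ⟨H, Λ, hH⟩ := hf
  let K : Finset (Fin n → ℝ) := Λ.image fun l i => (l i : ℝ)
  refine ⟨H ∪ K, insert 0 Λ, fun x₀ hx₀ => ?_⟩
  obtain ⟨l, hlΛ, hl⟩ := hH x₀ (hx₀.mono Finset.subset_union_left)
  have hlK : (fun i => (l i : ℝ)) ∈ H ∪ K :=
    Finset.mem_union_right _ (Finset.mem_image_of_mem _ hlΛ)
  have hsign : ∀ x ∈ closedCell (H ∪ K) x₀,
      0 ≤ ((fun i => (l i : ℝ)) ⬝ᵥ x₀) * ((fun i => (l i : ℝ)) ⬝ᵥ x) := fun x hx => hx _ hlK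
  have hval : ∀ x ∈ closedCell (H ∪ K) x₀, f x = (fun i => (l i : ℝ)) ⬝ᵥ x :=
    fun x hx => hl x (closedCell_anti Finset.subset_union_left hx)
  rcases lt_trichotomy ((fun i => (l i : ℝ)) ⬝ᵥ x₀) 0 with h | h | h
  · refine ⟨0, Finset.mem_insert_self _ _, fun x hx => ?_⟩
    have := nonpos_of_mul_nonneg_right (hsign x hx) h
    beta_reduce
    rw [hval x hx, max_eq_left this]
    simp
  · have h0 : (fun i => (l i : ℝ)) = 0 := by
      by_contra h0
      exact hx₀ _ hlK h0 h
    refine ⟨0, Finset.mem_insert_self _ _, fun x hx => ?_⟩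
    beta_reduce
    rw [hval x hx, h0]
    simp
  · refine ⟨l, Finset.mem_insert_of_mem hlΛ, fun x hx => ?_⟩
    have := nonneg_of_mul_nonneg_right (hsign x hx) h
    beta_reduce
    rw [hval x hx, max_eq_right this]
    rfl

end PiecewisePolynomial

/-! ### Jump sums in one variable. -/

/-- `HasJumpSum φ d` says that the continuous piecewise polynomial function `φ` of one variable is
a polynomial plus a sum of functions `t ↦ q(t) max(0, t - ℓ)`, where `d` is the sum of the
values `q(0)`. -/
def HasJumpSum (φ : ℝ → ℝ) (d : ℝ) : Prop :=
  ∃ (P : Polynomial ℝ) (Q : ℝ →₀ Polynomial ℝ),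
    (∀ t, φ t = P.eval t + Q.sum fun l q => q.eval t * max 0 (t - l)) ∧
      d = Q.sum fun _ q => q.eval 0

namespace HasJumpSum

theorem polynomial (P : Polynomial ℝ) : HasJumpSum (fun t => P.eval t) 0 :=
  ⟨P, 0, fun t => by simp, by simp⟩

theorem hinge (q : Polynomial ℝ) (l : ℝ) :
    HasJumpSum (fun t => q.eval t * max 0 (t - l)) (q.eval 0) :=
  ⟨0, Finsupp.single l q, fun t => by simp, by simp⟩

theorem add {φ ψ : ℝ → ℝ} {d e : ℝ} (hφ : HasJumpSum φ d) (hψ : HasJumpSum ψ e) :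
    HasJumpSum (fun t => φ t + ψ t) (d + e) := by
  obtain ⟨P, Q, h, rfl⟩ := hφ
  obtain ⟨P', Q', h', rfl⟩ := hψ
  refine ⟨P + P', Q + Q', fun t => ?_, ?_⟩
  · beta_reduce
    rw [Finsupp.sum_add_index' (by simp) (by simp [add_mul]), h, h', Polynomial.eval_add]
    ring
  · rw [Finsupp.sum_add_index' (by simp) (by simp)]

/-- This is why `q` is evaluated at `0`: the factor `R = X` annihilates the jump sum. -/
theorem polynomial_mul {φ : ℝ → ℝ} {d : ℝ} (hφ : HasJumpSum φ d) (R : Polynomial ℝ) :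
    HasJumpSum (fun t => R.eval t * φ t) (R.eval 0 * d) := by
  obtain ⟨P, Q, h, rfl⟩ := hφ
  refine ⟨R * P, R • Q, fun t => ?_, ?_⟩
  · beta_reduce
    rw [Finsupp.sum_smul_index' (by simp), h, mul_add, Polynomial.eval_mul, Finsupp.mul_sum]
    simp [mul_assoc]
  · rw [Finsupp.sum_smul_index' (by simp), Finsupp.mul_sum]
    simp

theorem const_mul {φ : ℝ → ℝ} {d : ℝ} (hφ : HasJumpSum φ d) (c : ℝ) :
    HasJumpSum (fun t => c * φ t) (c * d) := by
  simpa using hφ.polynomial_mul (Polynomial.C c)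

theorem sum {ι : Type*} (s : Finset ι) {φ : ι → ℝ → ℝ} {d : ι → ℝ}
    (h : ∀ i ∈ s, HasJumpSum (φ i) (d i)) :
    HasJumpSum (fun t => ∑ i ∈ s, φ i t) (∑ i ∈ s, d i) := by
  classical
  induction s using Finset.induction_on with
  | empty => simpa using polynomial 0
  | insert a s ha ih =>
    simp only [Finset.sum_insert ha]
    exact (h a (Finset.mem_insert_self _ _)).add
      (ih fun i hi => h i (Finset.mem_insert_of_mem hi))

/-- The polynomials `A` and `B` giving the function just left and just right of `m` both vanish, and
they differ by `Q m * (X - m)`. -/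
theorem eq_zero_of_sum_hinge_eq_zero {P : Polynomial ℝ} {Q : ℝ →₀ Polynomial ℝ}
    (h : ∀ t, P.eval t + Q.sum (fun l q => q.eval t * max 0 (t - l)) = 0) : Q = 0 := by
  classical
  ext1 m
  rw [Finsupp.zero_apply]
  by_contra hm
  have hmem : m ∈ Q.support := Finsupp.mem_support_iff.mpr hm
  let A : Polynomial ℝ := P + ∑ l ∈ Q.support with l < m, Q l * (Polynomial.X - Polynomial.C l)
  let B : Polynomial ℝ := P + ∑ l ∈ Q.support with l ≤ m, Q l * (Polynomial.X - Polynomial.C l)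
  have hA : A = 0 := by
    have hev : ∀ᶠ t in 𝓝[<] m, ∀ l ∈ Q.support, max 0 (t - l) = if l < m then t - l else 0 := by
      rw [Filter.eventually_all_finset]
      intro l _
      split_ifs with hl
      · filter_upwards [nhdsWithin_le_nhds (lt_mem_nhds hl)] with t ht
        exact max_eq_right (sub_nonneg.mpr (le_of_lt ht))
      · filter_upwards [self_mem_nhdsWithin] with t ht
        exact max_eq_left (by linarith [Set.mem_Iio.mp ht])
    obtain ⟨a, ha, hsub⟩ := mem_nhdsLT_iff_exists_Ioo_subset.mp hev
    refine Polynomial.eq_zero_of_infinite_isRoot _ ((Set.Ioo_infinite ha).mono fun t ht => ?_)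
    have ht' := hsub ht
    rw [Set.mem_ofPred_eq] at ht'
    rw [Set.mem_ofPred_eq, Polynomial.IsRoot.def, ← h t]
    simp only [A, Polynomial.eval_add, Polynomial.eval_finsetSum, Finsupp.sum, Finset.sum_filter]
    congr 1
    refine Finset.sum_congr rfl fun l hl => ?_
    rw [ht' l hl]
    split_ifs <;> simp
  have hB : B = 0 := by
    have hev : ∀ᶠ t in 𝓝[>] m, ∀ l ∈ Q.support, max 0 (t - l) = if l ≤ m then t - l else 0 := by
      rw [Filter.eventually_all_finset]
      intro l _
      split_ifs with hl
      · filter_upwards [self_mem_nhdsWithin] with t ht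
        exact max_eq_right (by linarith [Set.mem_Ioi.mp ht])
      · filter_upwards [nhdsWithin_le_nhds (gt_mem_nhds (not_le.mp hl))] with t ht
        exact max_eq_left (sub_nonpos.mpr (le_of_lt ht))
    obtain ⟨a, ha, hsub⟩ := mem_nhdsGT_iff_exists_Ioo_subset.mp hev
    refine Polynomial.eq_zero_of_infinite_isRoot _ ((Set.Ioo_infinite ha).mono fun t ht => ?_)
    have ht' := hsub ht
    rw [Set.mem_ofPred_eq] at ht'
    rw [Set.mem_ofPred_eq, Polynomial.IsRoot.def, ← h t]
    simp only [B, Polynomial.eval_add, Polynomial.eval_finsetSum, Finsupp.sum, Finset.sum_filter]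
    congr 1
    refine Finset.sum_congr rfl fun l hl => ?_
    rw [ht' l hl]
    split_ifs <;> simp
  have hBA : B = A + Q m * (Polynomial.X - Polynomial.C m) := by
    have : Q.support.filter (· ≤ m) = insert m (Q.support.filter (· < m)) := by
      ext l
      simp only [Finset.mem_filter, Finset.mem_insert]
      constructor
      · rintro ⟨h1, h2⟩
        rcases h2.eq_or_lt with h3 | h3
        exacts [Or.inl h3, Or.inr ⟨h1, h3⟩]
      · rintro (rfl | ⟨h1, h2⟩)
        exacts [⟨hmem, le_rfl⟩, ⟨h1, h2.le⟩]
    simp only [A, B]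
    rw [this, Finset.sum_insert (by simp)]
    ring
  rw [hA, hB, zero_add, eq_comm, mul_eq_zero] at hBA
  exact hBA.elim hm (Polynomial.X_sub_C_ne_zero m)

/-- Uniqueness lets jump sums computed over different cells be glued, and lets both sides of an
identity be compared. -/
theorem unique {φ : ℝ → ℝ} {d e : ℝ} (hd : HasJumpSum φ d) (he : HasJumpSum φ e) : d = e := by
  obtain ⟨P, Q, h, hQ⟩ := hd.add (he.const_mul (-1))
  have hQ0 : Q = 0 := eq_zero_of_sum_hinge_eq_zero (P := P) fun t => by rw [← h t]; ring
  rw [hQ0, Finsupp.sum_zero_index] at hQ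
  linarith

/-- The function `t ↦ max(t, m)^(n + 1)` has a single break point. -/
theorem max_pow (m : ℝ) (n : ℕ) : HasJumpSum (fun t => max t m ^ (n + 1)) (m ^ n) := by
  -- The quotient of `t ^ (n + 1) - m ^ (n + 1)` by `t - m`.
  let q : Polynomial ℝ := ∑ i ∈ Finset.range (n + 1), Polynomial.X ^ i * Polynomial.C m ^ (n - i)
  have hq : ∀ t, q.eval t * (t - m) = t ^ (n + 1) - m ^ (n + 1) := by
    intro t
    rw [← geom_sum₂_mul]
    simp [q, Polynomial.eval_finsetSum]
  have hq0 : q.eval 0 = m ^ n := by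
    simp only [q, Polynomial.eval_finsetSum, Polynomial.eval_mul, Polynomial.eval_pow,
      Polynomial.eval_X, Polynomial.eval_C]
    rw [Finset.sum_eq_single_of_mem 0 (by simp) fun i _ hi => by simp [hi]]
    simp
  have := (polynomial (Polynomial.C (m ^ (n + 1)))).add (hinge q m)
  rw [hq0, zero_add] at this
  convert this using 2 with t
  rw [Polynomial.eval_C]
  rcases le_total t m with h | h
  · rw [max_eq_right h, max_eq_left (sub_nonpos.mpr h)]
    ring
  · rw [max_eq_left h, max_eq_right (sub_nonneg.mpr h), hq]
    ring

end HasJumpSum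

/-! ### Order of the walls along vertical lines. -/

/-- A finite set of reals can be enumerated increasingly, with separating points in between. -/
theorem Finset.exists_separated_enumeration (L : Finset ℝ) :
    ∃ (m : ℕ) (e c : ℕ → ℝ), (∀ i < m, c i < e i ∧ e i < c (i + 1)) ∧
      L = (Finset.range m).image e := by
  -- The bound `c m < B` leaves room for the next maximum in the induction.
  suffices H : ∀ B : ℝ, (∀ x ∈ L, x < B) → ∃ (m : ℕ) (e c : ℕ → ℝ),
      (∀ i < m, c i < e i ∧ e i < c (i + 1)) ∧ L = (Finset.range m).image e ∧ c m < B by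
    obtain ⟨B, hB⟩ := L.bddAbove
    obtain ⟨m, e, c, h1, h2, -⟩ := H (B + 1) fun x hx => (hB hx).trans_lt (lt_add_one B)
    exact ⟨m, e, c, h1, h2⟩
  induction L using Finset.induction_on_max with
  | empty => exact fun B _ => ⟨0, 0, fun _ => B - 1, by simp, by simp, by simp⟩
  | insert a s ha ih =>
    intro B hB
    obtain ⟨m, e, c, h1, h2, h3⟩ := ih a ha
    have haB := hB a (Finset.mem_insert_self _ _)
    refine ⟨m + 1, Function.update e m a, Function.update c (m + 1) ((a + B) / 2), ?_, ?_, ?_⟩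
    · intro i hi
      rcases Nat.lt_succ_iff_lt_or_eq.mp hi with hi' | rfl
      · rw [Function.update_of_ne (by omega), Function.update_of_ne (by omega),
          Function.update_of_ne (by omega)]
        exact h1 i hi'
      · rw [Function.update_self, Function.update_of_ne (by omega), Function.update_self]
        exact ⟨h3, by linarith⟩
    · rw [Finset.range_add_one, Finset.image_insert, Function.update_self, h2]
      congr 1
      refine Finset.image_congr fun i hi => ?_
      rw [Function.update_of_ne (by simp at hi; omega)]
    · rw [Function.update_self]
      linarith

theorem closedCell_mem_nhds {n : ℕ} {H : Finset (Fin n → ℝ)} {x₀ : Fin n → ℝ}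
    (hx₀ : AvoidsWalls H x₀) : ∀ᶠ x in 𝓝 x₀, x ∈ closedCell H x₀ := by
  simp only [closedCell, Set.mem_ofPred_eq]
  rw [Filter.eventually_all_finset]
  intro h hh
  by_cases h0 : h = 0
  · simp [h0]
  · have hc : Continuous fun x : Fin n → ℝ => (h ⬝ᵥ x₀) * (h ⬝ᵥ x) := by fun_prop
    filter_upwards [(hc.tendsto x₀).eventually (lt_mem_nhds (mul_self_pos.mpr (hx₀ h hh h0)))]
      with x hx using hx.le

/-- An arrangement in `ℝⁿ` whose hyperplanes contain the projections, along the first coordinate,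
of the vertical hyperplanes of `H` and of the intersections of any two hyperplanes of `H`. -/
noncomputable def projectedWalls {n : ℕ} (H : Finset (Fin (n + 1) → ℝ)) : Finset (Fin n → ℝ) :=
  H.image Matrix.vecTail ∪
    Finset.image₂ (fun h h' => h 0 • Matrix.vecTail h' - h' 0 • Matrix.vecTail h) H H

/-- The height at which the hyperplane of the form `h` meets the vertical line over `y`. -/
noncomputable def wallHeight {n : ℕ} (h : Fin (n + 1) → ℝ) (y : Fin n → ℝ) : ℝ :=
  -(Matrix.vecTail h ⬝ᵥ y) / h 0

theorem dotProduct_vecCons_eq {n : ℕ} {h : Fin (n + 1) → ℝ} (h0 : h 0 ≠ 0) (t : ℝ)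
    (y : Fin n → ℝ) : h ⬝ᵥ Matrix.vecCons t y = h 0 * (t - wallHeight h y) := by
  rw [Matrix.dotProduct_cons, wallHeight, Matrix.vecHead]
  field_simp
  ring

section Fiber

variable {n : ℕ} {H : Finset (Fin (n + 1) → ℝ)} {y₀ y : Fin n → ℝ}

theorem vecTail_mem_projectedWalls {h : Fin (n + 1) → ℝ} (hh : h ∈ H) :
    Matrix.vecTail h ∈ projectedWalls H := by
  classical
  exact Finset.mem_union_left _ (Finset.mem_image_of_mem _ hh)

theorem sub_mem_projectedWalls {h h' : Fin (n + 1) → ℝ} (hh : h ∈ H) (hh' : h' ∈ H) :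
    h 0 • Matrix.vecTail h' - h' 0 • Matrix.vecTail h ∈ projectedWalls H := by
  classical
  exact Finset.mem_union_right _ (Finset.mem_image₂_of_mem hh hh')

theorem wallHeight_sub_wallHeight {h h' : Fin (n + 1) → ℝ} (h0 : h 0 ≠ 0) (h0' : h' 0 ≠ 0) :
    (h 0 • Matrix.vecTail h' - h' 0 • Matrix.vecTail h) ⬝ᵥ y =
      h 0 * h' 0 * (wallHeight h y - wallHeight h' y) := by
  rw [sub_dotProduct, smul_dotProduct, smul_dotProduct, wallHeight, wallHeight, smul_eq_mul,
    smul_eq_mul]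
  field_simp
  ring

/-- Up to the factor `h 0 * h' 0`, the difference of two heights is a form of the projected
arrangement, so its sign cannot reverse inside a cell. -/
theorem wallHeight_le_of_lt (hy : y ∈ closedCell (projectedWalls H) y₀)
    {h h' : Fin (n + 1) → ℝ} (hh : h ∈ H) (hh' : h' ∈ H) (h0 : h 0 ≠ 0) (h0' : h' 0 ≠ 0)
    (hlt : wallHeight h y₀ < wallHeight h' y₀) : wallHeight h y ≤ wallHeight h' y := by
  have key := hy _ (sub_mem_projectedWalls hh hh')
  rw [wallHeight_sub_wallHeight h0 h0', wallHeight_sub_wallHeight h0 h0'] at key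
  have hpos : 0 < (h 0 * h' 0) ^ 2 := by positivity
  have : 0 ≤ (h 0 * h' 0) ^ 2 *
      ((wallHeight h y₀ - wallHeight h' y₀) * (wallHeight h y - wallHeight h' y)) := by
    linarith
  have := nonneg_of_mul_nonneg_right this hpos
  linarith [nonpos_of_mul_nonneg_right this (by linarith)]

/-- A projected form vanishing at a point off all walls is the zero form. -/
theorem wallHeight_eq_of_eq (hy₀ : AvoidsWalls (projectedWalls H) y₀)
    {h h' : Fin (n + 1) → ℝ} (hh : h ∈ H) (hh' : h' ∈ H) (h0 : h 0 ≠ 0) (h0' : h' 0 ≠ 0)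
    (heq : wallHeight h y₀ = wallHeight h' y₀) (y : Fin n → ℝ) :
    wallHeight h y = wallHeight h' y := by
  have hz : h 0 • Matrix.vecTail h' - h' 0 • Matrix.vecTail h = 0 := by
    by_contra hne
    apply hy₀ _ (sub_mem_projectedWalls hh hh') hne
    rw [wallHeight_sub_wallHeight h0 h0', heq, sub_self, mul_zero]
  have := wallHeight_sub_wallHeight (y := y) h0 h0'
  rw [hz, zero_dotProduct, eq_comm, mul_eq_zero] at this
  exact sub_eq_zero.mp (this.resolve_left (mul_ne_zero h0 h0'))

theorem avoidsWalls_vecCons (hy₀ : AvoidsWalls (projectedWalls H) y₀) {c : ℝ}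
    (hc : ∀ h ∈ H, h 0 ≠ 0 → wallHeight h y₀ ≠ c) : AvoidsWalls H (Matrix.vecCons c y₀) := by
  intro h hh hne
  by_cases h0 : h 0 = 0
  · rw [Matrix.dotProduct_cons, Matrix.vecHead, h0, zero_mul, zero_add]
    apply hy₀ _ (vecTail_mem_projectedWalls hh)
    intro ht
    apply hne
    funext i
    refine Fin.cases h0 (fun j => ?_) i
    exact congrFun ht j
  · rw [dotProduct_vecCons_eq h0]
    exact mul_ne_zero h0 (sub_ne_zero.mpr (hc h hh h0).symm)

theorem vecCons_mem_closedCell (hy : y ∈ closedCell (projectedWalls H) y₀) {c t : ℝ}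
    (hct : ∀ h ∈ H, h 0 ≠ 0 → 0 ≤ (c - wallHeight h y₀) * (t - wallHeight h y)) :
    Matrix.vecCons t y ∈ closedCell H (Matrix.vecCons c y₀) := by
  intro h hh
  by_cases h0 : h 0 = 0
  · rw [Matrix.dotProduct_cons, Matrix.dotProduct_cons, Matrix.vecHead, h0, zero_mul, zero_add,
      zero_mul, zero_add]
    exact hy _ (vecTail_mem_projectedWalls hh)
  · rw [dotProduct_vecCons_eq h0, dotProduct_vecCons_eq h0]
    have := mul_nonneg (mul_self_nonneg (h 0)) (hct h hh h0)
    linarith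

end Fiber

/-! ### Jump sums along vertical lines. -/

/-- Over a full-dimensional cell of the projected arrangement, the restrictions of a piecewise
polynomial function to vertical lines are sums of hinges with integral coefficients. -/
theorem exists_hinge_expansion {O : ValuationSubring ℝ} {n : ℕ} {f : (Fin (n + 1) → ℝ) → ℝ}
    {H : Finset (Fin (n + 1) → ℝ)}
    (hf : ∀ x₀, AvoidsWalls H x₀ →
      ∃ g : MvPolynomial (Fin (n + 1)) O, ∀ x ∈ closedCell H x₀, f x = aeval x g)
    {y₀ : Fin n → ℝ} (hy₀ : AvoidsWalls (projectedWalls H) y₀) :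
    ∃ (m : ℕ) (l : ℕ → (Fin n → ℝ) → ℝ) (g : MvPolynomial (Fin (n + 1)) O)
      (q : ℕ → MvPolynomial (Fin (n + 1)) O), ∀ y ∈ closedCell (projectedWalls H) y₀, ∀ t,
        f (Matrix.vecCons t y) = aeval (Matrix.vecCons t y) g +
          ∑ i ∈ Finset.range m, aeval (Matrix.vecCons t y) (q i) * max 0 (t - l i y) := by
  classical
  obtain ⟨m, e, c, hec, hL⟩ := Finset.exists_separated_enumeration
    ((H.filter fun h => h 0 ≠ 0).image fun h => wallHeight h y₀)
  have hwall : ∀ i, ∃ h : Fin (n + 1) → ℝ, i < m → h ∈ H ∧ h 0 ≠ 0 ∧ wallHeight h y₀ = e i := by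
    intro i
    by_cases hi : i < m
    · have : e i ∈ (Finset.range m).image e :=
        Finset.mem_image_of_mem _ (Finset.mem_range.mpr hi)
      rw [← hL] at this
      obtain ⟨h, hh, he⟩ := Finset.mem_image.mp this
      exact ⟨h, fun _ => ⟨(Finset.mem_filter.mp hh).1, (Finset.mem_filter.mp hh).2, he⟩⟩
    · exact ⟨0, fun h => absurd h hi⟩
  choose h hh using hwall
  have hindex : ∀ h' ∈ H, h' 0 ≠ 0 → ∃ i < m, wallHeight h' y₀ = e i ∧
      ∀ y, wallHeight h' y = wallHeight (h i) y := by
    intro h' hh' h0'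
    have : wallHeight h' y₀ ∈ (Finset.range m).image e := by
      rw [← hL]
      exact Finset.mem_image_of_mem _ (Finset.mem_filter.mpr ⟨hh', h0'⟩)
    obtain ⟨i, hi, he⟩ := Finset.mem_image.mp this
    have hi := Finset.mem_range.mp hi
    obtain ⟨hiH, hi0, hie⟩ := hh i hi
    exact ⟨i, hi, he.symm, wallHeight_eq_of_eq hy₀ hh' hiH h0' hi0 (he.symm.trans hie.symm)⟩
  have hcmono : ∀ i j, i ≤ j → j ≤ m → c i ≤ c j := by
    intro i j hij
    induction j, hij using Nat.le_induction with
    | base => exact fun _ => le_rfl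
    | succ j _ ih =>
      exact fun hjm => (ih (by omega)).trans ((hec j (by omega)).1.trans (hec j (by omega)).2).le
  have hlow : ∀ i j, i < j → j ≤ m → e i < c j := fun i j hij hjm =>
    (hec i (by omega)).2.trans_le (hcmono (i + 1) j hij hjm)
  have hhigh : ∀ i j, j ≤ i → i < m → c j < e i := fun i j hij him =>
    (hcmono j i hij him.le).trans_lt (hec i him).1
  have hmono : ∀ y ∈ closedCell (projectedWalls H) y₀, ∀ i j, i ≤ j → j < m →
      wallHeight (h i) y ≤ wallHeight (h j) y := by
    intro y hy i j hij hjm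
    rcases hij.eq_or_lt with rfl | hlt
    · exact le_rfl
    · obtain ⟨h1, h2, h3⟩ := hh i (by omega)
      obtain ⟨h1', h2', h3'⟩ := hh j hjm
      refine wallHeight_le_of_lt hy h1 h1' h2 h2' ?_
      rw [h3, h3']
      exact (hlow i j hlt hjm.le).trans (hec j hjm).1
  -- The strip between consecutive walls lies in the cell of `(c j, y₀)`, so a single polynomial
  -- serves the whole strip.
  have hpiece : ∀ j, ∃ g : MvPolynomial (Fin (n + 1)) O, j ≤ m →
      ∀ y ∈ closedCell (projectedWalls H) y₀, ∀ t, (∀ i < j, wallHeight (h i) y ≤ t) →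
        (∀ i, j ≤ i → i < m → t ≤ wallHeight (h i) y) →
          f (Matrix.vecCons t y) = aeval (Matrix.vecCons t y) g := by
    intro j
    by_cases hj : j ≤ m
    · obtain ⟨g, hg⟩ := hf (Matrix.vecCons (c j) y₀) <| by
        refine avoidsWalls_vecCons hy₀ fun h' hh' h0' => ?_
        obtain ⟨i, him, hie, -⟩ := hindex h' hh' h0'
        rw [hie]
        rcases lt_or_ge i j with hij | hij
        exacts [(hlow i j hij hj).ne, (hhigh i j hij him).ne']
      refine ⟨g, fun _ y hy t hlo hhi => hg _ (vecCons_mem_closedCell hy fun h' hh' h0' => ?_)⟩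
      obtain ⟨i, him, hie, hiy⟩ := hindex h' hh' h0'
      rw [hie, hiy]
      rcases lt_or_ge i j with hij | hij
      · exact mul_nonneg (sub_nonneg.mpr (hlow i j hij hj).le) (sub_nonneg.mpr (hlo i hij))
      · exact mul_nonneg_of_nonpos_of_nonpos (sub_nonpos.mpr (hhigh i j hij him).le)
          (sub_nonpos.mpr (hhi i hij him))
    · exact ⟨0, fun h => absurd h hj⟩
  choose g hg using hpiece
  -- Adjacent pieces agree on their common wall, so the difference is divisible over `O` by the
  -- normalized form `w` of that wall.
  have hjump : ∀ j, ∃ q : MvPolynomial (Fin (n + 1)) O, j < m → ∀ t y,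
      aeval (Matrix.vecCons t y) (g (j + 1)) - aeval (Matrix.vecCons t y) (g j) =
        aeval (Matrix.vecCons t y) q * (t - wallHeight (h j) y) := by
    intro j
    by_cases hj : j < m
    swap
    · exact ⟨0, fun h => absurd h hj⟩
    obtain ⟨hjH, hj0, hje⟩ := hh j hj
    obtain ⟨k, w, i, hk, hwi, hw⟩ := exists_normalized_vector O (h j)
      fun h0 => hj0 (by rw [h0]; rfl)
    have hwx : ∀ t y, ∑ i, (w i : ℝ) * Matrix.vecCons t y i = w 0 * (t - wallHeight (h j) y) := by
      intro t y
      apply mul_left_cancel₀ hk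
      rw [← mul_assoc, ← hw 0, ← dotProduct_vecCons_eq hj0, dotProduct, Finset.mul_sum]
      exact Finset.sum_congr rfl fun i _ => by rw [hw i, mul_assoc]
    have hw0 : (w 0 : ℝ) ≠ 0 := fun h0 => hj0 (by rw [hw 0, h0, mul_zero])
    obtain ⟨q, hq⟩ := MvPolynomial.exists_eq_linear_mul w hwi (g (j + 1) - g j)
      (Matrix.vecCons (e j) y₀) (by rw [hwx, hje, sub_self, mul_zero]) <| by
        have htail : Tendsto (fun x : Fin (n + 1) → ℝ => Matrix.vecTail x)
            (𝓝 (Matrix.vecCons (e j) y₀)) (𝓝 y₀) := by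
          have hcont : Continuous fun x : Fin (n + 1) → ℝ => Matrix.vecTail x :=
            continuous_pi fun i => continuous_apply _
          simpa using hcont.tendsto (Matrix.vecCons (e j) y₀)
        filter_upwards [htail.eventually (closedCell_mem_nhds hy₀)] with x hx hxw
        rw [← Matrix.cons_head_tail x] at hxw ⊢
        rw [hwx, mul_eq_zero, sub_eq_zero] at hxw
        have ht := hxw.resolve_left hw0
        rw [map_sub, sub_eq_zero]
        rw [← hg (j + 1) hj _ hx, ← hg j hj.le _ hx]
        · intro i hi
          rw [ht]
          exact hmono _ hx i j hi.le hj
        · intro i hi him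
          rw [ht]
          exact hmono _ hx j i hi him
        · intro i hi
          rw [ht]
          exact hmono _ hx i j (by omega) hj
        · intro i hi him
          rw [ht]
          exact hmono _ hx j i (by omega) him
    -- On vertical lines `w` equals `w 0 * (t - height)`. Its leading coefficient is integral and is
    -- absorbed into the quotient, so no division is needed.
    refine ⟨C (w 0) * q, fun _ t y => ?_⟩
    have hC : ∀ (x : Fin (n + 1) → ℝ) (a : O), aeval x (C a) = (a : ℝ) := fun x a => aeval_C x a
    rw [← map_sub, hq, map_mul, map_mul, map_sum, hC]
    simp only [map_mul, aeval_X, hC]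
    rw [hwx]
    ring
  choose q hq using hjump
  refine ⟨m, fun i => wallHeight (h i), g 0, q, fun y hy t => ?_⟩
  -- `J` counts the walls strictly below `t`. The first `J` jumps telescope and the remaining hinges
  -- vanish.
  have hex : ∃ J, J < m → t ≤ wallHeight (h J) y := ⟨m, fun h => absurd h (lt_irrefl _)⟩
  obtain ⟨J, hJ, hmin⟩ : ∃ J, (J < m → t ≤ wallHeight (h J) y) ∧
      ∀ i < J, i < m ∧ wallHeight (h i) y < t :=
    ⟨Nat.find hex, Nat.find_spec hex, fun i hi => by simpa using Nat.find_min hex hi⟩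
  have hJm : J ≤ m := by
    by_contra hlt
    exact lt_irrefl m (hmin m (not_le.mp hlt)).1
  have hhi : ∀ i, J ≤ i → i < m → t ≤ wallHeight (h i) y := fun i hi him =>
    (hJ (hi.trans_lt him)).trans (hmono y hy J i hi him)
  rw [hg J hJm y hy t (fun i hi => (hmin i hi).2.le) hhi]
  have htele := Finset.sum_range_sub (fun j => aeval (Matrix.vecCons t y) (g j)) J
  rw [eq_comm, sub_eq_iff_eq_add'] at htele
  rw [htele]
  congr 1
  rw [← Finset.sum_subset (Finset.range_subset_range.mpr hJm)]
  · refine Finset.sum_congr rfl fun i hi => ?_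
    have hi := hmin i (Finset.mem_range.mp hi)
    rw [hq i hi.1, max_eq_right (sub_nonneg.mpr hi.2.le)]
  · intro i him hiJ
    rw [Finset.mem_range] at him hiJ
    rw [max_eq_left (sub_nonpos.mpr (hhi i (not_lt.mp hiJ) him)), mul_zero]

/-- The fibrewise jump sum of a piecewise polynomial function is piecewise polynomial. -/
theorem IsPiecewisePolynomial.exists_jumpSum {O : ValuationSubring ℝ} {n : ℕ}
    {f : (Fin (n + 1) → ℝ) → ℝ} (hf : IsPiecewisePolynomial O f) :
    ∃ d : (Fin n → ℝ) → ℝ, IsPiecewisePolynomial O d ∧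
      ∀ y, HasJumpSum (fun t => f (Matrix.vecCons t y)) (d y) := by
  obtain ⟨H, hH⟩ := hf
  have key : ∀ y₀, AvoidsWalls (projectedWalls H) y₀ → ∃ r : MvPolynomial (Fin n) O,
      ∀ y ∈ closedCell (projectedWalls H) y₀,
        HasJumpSum (fun t => f (Matrix.vecCons t y)) (aeval y r) := by
    intro y₀ hy₀
    obtain ⟨m, l, g, q, hfy⟩ := exists_hinge_expansion hH hy₀
    refine ⟨∑ i ∈ Finset.range m, bind₁ (Matrix.vecCons 0 X) (q i), fun y hy => ?_⟩
    let P : MvPolynomial (Fin (n + 1)) O → Polynomial ℝ :=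
      fun a => aeval (Matrix.vecCons Polynomial.X fun i => Polynomial.C (y i)) a
    have hP : ∀ t a, (P a).eval t = aeval (Matrix.vecCons t y) a := by
      intro t a
      have : ((Polynomial.aeval t).restrictScalars O).comp
          (aeval (Matrix.vecCons Polynomial.X fun i => Polynomial.C (y i)) :
            MvPolynomial (Fin (n + 1)) O →ₐ[O] Polynomial ℝ) = aeval (Matrix.vecCons t y) := by
        apply MvPolynomial.algHom_ext
        intro i
        refine Fin.cases ?_ (fun j => ?_) i <;> simp
      exact congrArg (fun φ => φ a) this
    have h0 : aeval y (∑ i ∈ Finset.range m, bind₁ (Matrix.vecCons 0 X) (q i)) =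
        0 + ∑ i ∈ Finset.range m, (P (q i)).eval 0 := by
      rw [zero_add, map_sum]
      refine Finset.sum_congr rfl fun i _ => ?_
      rw [aeval_bind₁, hP]
      congr 2
      funext j
      refine Fin.cases ?_ (fun j => ?_) j <;> simp
    rw [h0]
    have := (HasJumpSum.polynomial (P g)).add
      (HasJumpSum.sum (Finset.range m) fun i _ => HasJumpSum.hinge (P (q i)) (l i y))
    convert this using 2 with t
    rw [hfy y hy t]
    simp only [hP]
  have hex : ∀ y, ∃ d, HasJumpSum (fun t => f (Matrix.vecCons t y)) d := by
    intro y
    obtain ⟨y₀, hy₀, hy⟩ := exists_mem_closedCell (projectedWalls H) y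
    obtain ⟨r, hr⟩ := key y₀ hy₀
    exact ⟨_, hr y hy⟩
  choose d hd using hex
  refine ⟨d, ⟨projectedWalls H, fun y₀ hy₀ => ?_⟩, hd⟩
  obtain ⟨r, hr⟩ := key y₀ hy₀
  exact ⟨r, fun y hy => (hd y).unique (hr y hy)⟩

/-! ### The `n`-th power of the maximum is not in the ideal. -/

theorem maxZero_le_iff {n : ℕ} {x : Fin n → ℝ} {c : ℝ} :
    maxZero n x ≤ c ↔ 0 ≤ c ∧ ∀ i, x i ≤ c := by
  rw [maxZero, Finset.sup'_le_iff]
  simp [Fin.forall_fin_succ]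

theorem maxZero_vecCons {n : ℕ} (t : ℝ) (y : Fin n → ℝ) :
    maxZero (n + 1) (Matrix.vecCons t y) = max t (maxZero n y) := by
  refine eq_of_forall_ge_iff fun c => ?_
  rw [max_le_iff, maxZero_le_iff, maxZero_le_iff, Fin.forall_fin_succ]
  simp only [Matrix.cons_val_zero, Matrix.cons_val_succ]
  tauto

theorem maxZero_smul {n : ℕ} {c : ℝ} (hc : 0 ≤ c) (x : Fin n → ℝ) :
    maxZero n (c • x) = c * maxZero n x := by
  induction n with
  | zero => simp [maxZero]
  | succ n ih =>
    rw [← Matrix.cons_head_tail x, Matrix.smul_cons, maxZero_vecCons, maxZero_vecCons, ih,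
      smul_eq_mul, mul_max_of_nonneg _ _ hc]

/-- The `n`-th power of `max {0, x₁, …, xₙ}` is not in the ideal that `p` and the coordinate
functions generate in the ring of piecewise polynomial functions. -/
theorem maxZero_pow_ne {O : ValuationSubring ℝ} {p : ℕ} (hp : (p : ℝ)⁻¹ ∉ O) (n : ℕ)
    (a : (Fin n → ℝ) → ℝ) (ha : IsPiecewisePolynomial O a) (b : Fin n → (Fin n → ℝ) → ℝ)
    (hb : ∀ i, IsPiecewisePolynomial O (b i)) :
    ¬ ∀ x, maxZero n x ^ n = p * a x + ∑ i, x i * b i x := by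
  induction n with
  | zero =>
    intro h
    obtain ⟨H, hH⟩ := ha
    obtain ⟨x₀, hx₀, hx⟩ := exists_mem_closedCell H 0
    obtain ⟨g, hg⟩ := hH x₀ hx₀
    have h1 := h 0
    have hmem : aeval (0 : Fin 0 → ℝ) g = ((constantCoeff g : O) : ℝ) := by
      rw [MvPolynomial.aeval_zero]
      rfl
    rw [hg 0 hx, hmem] at h1
    simp only [pow_zero, Finset.univ_eq_empty, Finset.sum_empty, add_zero] at h1
    rw [inv_eq_of_mul_eq_one_right h1.symm] at hp
    exact hp (constantCoeff g).2
  | succ n ih =>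
    intro h
    obtain ⟨a', ha', hda⟩ := ha.exists_jumpSum
    choose b' hb' hdb using fun i => (hb i).exists_jumpSum
    -- Jump sums of both sides: the left gives `maxZero n y ^ n`, and the term with factor `t`
    -- disappears.
    refine ih a' ha' (fun i => b' i.succ) (fun i => hb' _) fun y => ?_
    have h1 := HasJumpSum.max_pow (maxZero n y) n
    have h2 := ((hda y).const_mul p).add
      (((hdb 0 y).polynomial_mul Polynomial.X).add
        (HasJumpSum.sum Finset.univ fun i _ => (hdb (Fin.succ i) y).const_mul (y i)))
    rw [Polynomial.eval_X, zero_mul, zero_add] at h2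
    refine h1.unique ?_
    convert h2 using 2 with t
    rw [← maxZero_vecCons, h, Fin.sum_univ_succ]
    simp

/-! ### Powers of neurons in the ideal. -/

section Ideal

variable (O : ValuationSubring ℝ) (p n : ℕ)

/-- The `i`-th coordinate as an element of the ring of piecewise polynomial functions. -/
def coordFunction (i : Fin n) : piecewisePolynomialRing O n :=
  ⟨fun x => x i, (isPiecewiseLinear_coord i).isPiecewisePolynomial⟩

/-- The ideal generated by `p` and the coordinate functions. -/
def primeCoordIdeal : Ideal (piecewisePolynomialRing O n) :=
  Ideal.span {(p : piecewisePolynomialRing O n)} ⊔ Ideal.span (Set.range (coordFunction O n))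

variable {O p n}

theorem coordFunction_mem (i : Fin n) : coordFunction O n i ∈ primeCoordIdeal O p n :=
  Ideal.mem_sup_right (Ideal.subset_span ⟨i, rfl⟩)

theorem maxZero_pow_notMem (hp : (p : ℝ)⁻¹ ∉ O) (f : piecewisePolynomialRing O n)
    (hf : ∀ x, f.1 x = maxZero n x) : f ^ n ∉ primeCoordIdeal O p n := by
  intro hmem
  obtain ⟨u, hu, v, hv, huv⟩ := Submodule.mem_sup.mp hmem
  obtain ⟨a, rfl⟩ := Ideal.mem_span_singleton.mp hu
  obtain ⟨b, rfl⟩ := Ideal.mem_span_range_iff_exists_fun.mp hv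
  refine maxZero_pow_ne hp n a.1 a.2 (fun i => (b i).1) (fun i => (b i).2) fun x => ?_
  have := congrFun (congrArg Subtype.val huv) x
  rw [← hf x]
  simp only [Subring.coe_add, Subring.coe_mul, Subring.coe_natCast, Subring.coe_pow, Pi.add_apply,
    Pi.mul_apply, Pi.pow_apply, AddSubmonoidClass.coe_finsetSum, Finset.sum_apply] at this
  rw [← this]
  congr 1
  exact Finset.sum_congr rfl fun i _ => mul_comm _ _

/-- Frobenius: `(f + g) ^ p ^ j` and `f ^ p ^ j + g ^ p ^ j` differ by a multiple of `p`. -/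
theorem add_pow_prime_pow_mem (hp : p.Prime) (j : ℕ) {f g : piecewisePolynomialRing O n}
    (hf : f ^ p ^ j ∈ primeCoordIdeal O p n) (hg : g ^ p ^ j ∈ primeCoordIdeal O p n) :
    (f + g) ^ p ^ j ∈ primeCoordIdeal O p n := by
  obtain ⟨r, hr⟩ := exists_add_pow_prime_pow_eq hp f g j
  rw [hr]
  refine add_mem (add_mem hf hg) ?_
  rw [mul_assoc, mul_assoc]
  exact Ideal.mul_mem_right _ _ (Ideal.mem_sup_left (Ideal.mem_span_singleton_self _))

/-- `f` is piecewise linear over `O` and `f ^ p ^ j` lies in the ideal generated by `p` and the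
coordinate functions. -/
def HasPowerInIdeal (O : ValuationSubring ℝ) (p j : ℕ) {n : ℕ} (f : (Fin n → ℝ) → ℝ) : Prop :=
  ∃ hf : IsPiecewiseLinear O f,
    (⟨f, hf.isPiecewisePolynomial⟩ : piecewisePolynomialRing O n) ^ p ^ j ∈ primeCoordIdeal O p n

theorem HasPowerInIdeal.linearCombination (hp : p.Prime) {j l : ℕ}
    {φ : Fin l → (Fin n → ℝ) → ℝ} (hφ : ∀ i, HasPowerInIdeal O p j (φ i)) {c : Fin l → ℝ}
    (hc : ∀ i, c i ∈ O) : HasPowerInIdeal O p j (∑ i, c i • φ i) := by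
  refine Finset.sum_induction (fun i => c i • φ i) (HasPowerInIdeal O p j) ?_ ?_ fun i _ => ?_
  · rintro f g ⟨hf, hfI⟩ ⟨hg, hgI⟩
    exact ⟨hf.add hg, add_pow_prime_pow_mem hp j hfI hgI⟩
  · refine ⟨isPiecewiseLinear_zero, ?_⟩
    have : (⟨0, isPiecewiseLinear_zero.isPiecewisePolynomial⟩ : piecewisePolynomialRing O n) = 0 :=
      rfl
    rw [this, zero_pow (pow_ne_zero _ hp.ne_zero)]
    exact zero_mem _
  · obtain ⟨hf, hfI⟩ := hφ i
    refine ⟨hf.smul (hc i), ?_⟩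
    let C' : piecewisePolynomialRing O n := ⟨fun _ => c i, isPiecewisePolynomial_const (hc i)⟩
    have : (⟨c i • φ i, (hf.smul (hc i)).isPiecewisePolynomial⟩ : piecewisePolynomialRing O n) =
        C' * ⟨φ i, hf.isPiecewisePolynomial⟩ := rfl
    rw [this, mul_pow]
    exact Ideal.mul_mem_left _ _ hfI

/-- For `R = max 0 F`, `R² = R F` gives `R ^ (m + 1) = R F ^ m`. Take `m + 1 = p ^ (j + 1)`; then `m
≥ p ^ j`. -/
theorem HasPowerInIdeal.max_zero (hp : p.Prime) {j : ℕ} {f : (Fin n → ℝ) → ℝ}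
    (hf : HasPowerInIdeal O p j f) : HasPowerInIdeal O p (j + 1) fun x => max 0 (f x) := by
  obtain ⟨hl, hI⟩ := hf
  refine ⟨hl.max_zero, ?_⟩
  set F : piecewisePolynomialRing O n := ⟨f, hl.isPiecewisePolynomial⟩
  set R : piecewisePolynomialRing O n := ⟨fun x => max 0 (f x), hl.max_zero.isPiecewisePolynomial⟩
  have hRF : ∀ m, R ^ (m + 1) = R * F ^ m := by
    intro m
    induction m with
    | zero => simp
    | succ m ih =>
      have hRR : R * R = R * F := by
        apply Subtype.ext
        funext x
        change max 0 (f x) * max 0 (f x) = max 0 (f x) * f x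
        rcases le_total (f x) 0 with h | h
        · simp [max_eq_left h]
        · simp [max_eq_right h]
      rw [pow_succ, ih, pow_succ, mul_right_comm, hRR]
      ring
  have hlt : p ^ j < p ^ (j + 1) := Nat.pow_lt_pow_right hp.one_lt (Nat.lt_succ_self j)
  obtain ⟨d, hd⟩ := Nat.exists_eq_add_of_lt hlt
  rw [hd, hRF, pow_add, ← mul_assoc, mul_right_comm]
  exact Ideal.mul_mem_left _ _ hI

end Ideal

/-! ### Removing biases and propagating through the layers. -/

namespace ReLUNetwork

/-- The function computed by the network with all biases replaced by zero. -/
noncomputable def homogeneousEval :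
    {k n m : ℕ} → ReLUNetwork k n m → (Fin n → ℝ) → (Fin m → ℝ)
  | _, _, _, output A _, x => A *ᵥ x
  | _, _, _, hidden A _ net, x => net.homogeneousEval (relu (A *ᵥ x))

/-- After scaling, the bias contributes `s⁻¹ • b`, which tends to zero. -/
theorem tendsto_affine {n m : ℕ} (A : Matrix (Fin m) (Fin n) ℝ) (b : Fin m → ℝ)
    {u : ℝ → Fin n → ℝ} {x : Fin n → ℝ} (hu : Tendsto (fun s => s⁻¹ • u s) atTop (𝓝 x)) :
    Tendsto (fun s => s⁻¹ • (A *ᵥ u s + b)) atTop (𝓝 (A *ᵥ x)) := by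
  have hA : Continuous fun v : Fin n → ℝ => A *ᵥ v := by fun_prop
  have h1 : Tendsto (fun s : ℝ => A *ᵥ (s⁻¹ • u s) + s⁻¹ • b) atTop (𝓝 (A *ᵥ x + (0 : ℝ) • b)) :=
    ((hA.tendsto x).comp hu).add (tendsto_inv_atTop_zero.smul_const b)
  rw [zero_smul, add_zero] at h1
  refine h1.congr fun s => ?_
  rw [smul_add, Matrix.mulVec_smul]

/-- The homogeneous network computes the recession function of the network. -/
theorem tendsto_eval {k n m : ℕ} (net : ReLUNetwork k n m) {u : ℝ → Fin n → ℝ} {x : Fin n → ℝ}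
    (hu : Tendsto (fun s => s⁻¹ • u s) atTop (𝓝 x)) :
    Tendsto (fun s => s⁻¹ • net.eval (u s)) atTop (𝓝 (net.homogeneousEval x)) := by
  induction net with
  | output A b => exact tendsto_affine A b hu
  | @hidden _ _ l _ A b net ih =>
    refine ih ?_
    have hrelu : Continuous fun v : Fin l → ℝ => relu v := by
      unfold relu
      fun_prop
    refine ((hrelu.tendsto _).comp (tendsto_affine A b hu)).congr' ?_
    filter_upwards [eventually_gt_atTop 0] with s hs
    funext i
    have hs' : (0 : ℝ) ≤ s⁻¹ := (inv_pos.mpr hs).le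
    simp only [relu, Function.comp_apply, Pi.smul_apply, smul_eq_mul]
    rw [mul_max_of_nonneg _ _ hs', mul_zero]

theorem homogeneousEval_eq_maxZero {k n : ℕ} (net : ReLUNetwork k n 1)
    (hrep : net.Represents (maxZero n)) (x : Fin n → ℝ) :
    net.homogeneousEval x 0 = maxZero n x := by
  have hu : Tendsto (fun s : ℝ => s⁻¹ • (s • x)) atTop (𝓝 x) := by
    refine tendsto_const_nhds.congr' ?_
    filter_upwards [eventually_ne_atTop 0] with s hs
    rw [smul_smul, inv_mul_cancel₀ hs, one_smul]
  have h1 := (tendsto_pi_nhds.mp (net.tendsto_eval hu)) 0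
  refine tendsto_nhds_unique h1 (tendsto_const_nhds.congr' ?_)
  filter_upwards [eventually_gt_atTop 0] with s hs
  rw [Pi.smul_apply, hrep, maxZero_smul hs.le, smul_eq_mul, inv_mul_cancel_left₀ hs.ne']

/-- Each hidden layer costs one factor `p` in the exponent; the output layer, being linear, costs
none. -/
theorem hasPowerInIdeal_homogeneousEval {O : ValuationSubring ℝ} {p : ℕ} (hp : p.Prime)
    {P : ℝ → Prop} (hP : ∀ r, P r → r ∈ O) {k l m : ℕ} (net : ReLUNetwork k l m)
    (hw : net.AllWeights P) {n j : ℕ} {φ : Fin l → (Fin n → ℝ) → ℝ}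
    (hφ : ∀ i, HasPowerInIdeal O p j (φ i)) (i : Fin m) :
    HasPowerInIdeal O p (j + k) fun x => net.homogeneousEval (fun i' => φ i' x) i := by
  have hlin : ∀ {l m : ℕ} (A : Matrix (Fin m) (Fin l) ℝ) (φ : Fin l → (Fin n → ℝ) → ℝ) (i : Fin m),
      (fun x => (A *ᵥ fun i' => φ i' x) i) = ∑ i', A i i' • φ i' := by
    intro l m A φ i
    funext x
    simp [Matrix.mulVec, dotProduct]
  induction net generalizing j with
  | output A b =>
    have := HasPowerInIdeal.linearCombination hp hφ (c := A i) fun i' => hP _ (hw i i')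
    rw [← hlin] at this
    exact this
  | hidden A b net ih =>
    have hlayer : ∀ i', HasPowerInIdeal O p (j + 1)
        fun x => relu (A *ᵥ fun i' => φ i' x) i' := by
      intro i'
      have := HasPowerInIdeal.linearCombination hp hφ (c := A i') fun i'' => hP _ (hw.1 i' i'')
      rw [← hlin] at this
      exact this.max_zero hp
    have := ih hw.2 hlayer i
    rw [add_assoc, add_comm 1] at this
    exact this

end ReLUNetwork

/-! ### The depth bound. -/

theorem lt_pow_of_represents_maxZero {n N p k : ℕ} (hp : p.Prime) (hpN : ¬ p ∣ N)
    (net : ReLUNetwork k n 1) (hw : net.AllWeights (IsNaryFraction N))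
    (hrep : net.Represents (maxZero n)) : n < p ^ k := by
  obtain ⟨O, hpO, hO⟩ := exists_valuationSubring_nary hp hpN
  by_contra hlt
  have hcoord : ∀ i : Fin n, HasPowerInIdeal O p 0 fun x : Fin n → ℝ => x i := fun i =>
    ⟨isPiecewiseLinear_coord i, by
      rw [pow_zero, pow_one]
      exact coordFunction_mem i⟩
  obtain ⟨hl, hI⟩ := ReLUNetwork.hasPowerInIdeal_homogeneousEval hp hO net hw hcoord 0
  rw [zero_add] at hI
  refine maxZero_pow_notMem hpO ⟨_, hl.isPiecewisePolynomial⟩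
    (net.homogeneousEval_eq_maxZero hrep) ?_
  exact Ideal.pow_mem_of_pow_mem _ hI (not_lt.mp hlt)

theorem mainTheorem1 (n N p : ℕ) (hn : 0 < n) (hN : 0 < N) (hp : p.Prime) (hpN : ¬ p ∣ N)
    (k : ℕ) (net : ReLUNetwork k n 1) (hw : net.AllWeights (IsNaryFraction N))
    (hrep : net.Represents (maxZero n)) :
    ⌈Real.logb (p : ℝ) ((n : ℝ) + 1)⌉₊ ≤ k := by
  have hlt : n + 1 ≤ p ^ k := lt_pow_of_represents_maxZero hp hpN net hw hrep
  have hp1 : (1 : ℝ) < p := by exact_mod_cast hp.one_lt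
  rw [Nat.ceil_le, Real.logb_le_iff_le_rpow hp1 (by positivity), Real.rpow_natCast]
  exact_mod_cast hlt
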